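/- Let $(D,\mu)$ be a probability space, let $1\le m\le n$ be integers, and let $V_m$ be an $m$-dimensional complex vector space of functions $f\colon D\to\mathbb C$ (genuine functions, not equivalence classes) that are square-integrable with respect to $\mu$. Write $\|\cdot\|_2$ for the norm of $L_2(D,\mu)$. Let $H\neq\{0\}$ be a reproducing kernel Hilbert space of complex-valued functions on $D$ with kernel $K$, that is, a Hilbert space of functions on which all point evaluations are continuous. Assume that all functions in $H$ are square-integrable and that $$\lambda:=\sup_{0\ne f\in H}\frac{\|f\|_2^2}{\|f\|_H^2}<\infty,\qquad \|f\|_2\neq 0\ \text{ for all } f\in H\setminus\{0\},\qquad \operatorname{Tr}(K):=\int_D K(x,x)\,d\mu(x)<\infty,$$ and that $\int_D f\,d\mu=0$ for all $f\in H$. Put $M:=\operatorname{Tr}(K)/\lambda$. Then there exist points $x_1,\dots,x_n\in D$ and weights $w_1,\dots,w_n>0$ such that $$\left(1-\sqrt{\frac{m-1}{n}}\right)\|f\|_2\le\sqrt{\sum_{i=1}^n w_i|f(x_i)|^2}\qquad\text{for all } f\in V_m,$$ $$\sqrt{\sum_{i=1}^n w_i|g(x_i)|^2}\le\left(1+\sqrt{\frac{M}{n}}\right)\sqrt{\lambda}\,\|g\|_H\qquad\text{for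 all } g\in H,$$ and $$\sum_{i=1}^n w_i\le\left(1+\sqrt{\frac{M}{n}}\right)^2 .$$ -/

import Mathlib

open MeasureTheory

noncomputable section

namespace NormDiscretization

/-- The norm `‖f‖_{L₂(D,μ)}` of a square-integrable function `f : D → ℂ` (a genuine function,
not an equivalence class). -/
def l2Norm {D : Type*} [MeasurableSpace D] (μ : Measure D) (f : D → ℂ) : ℝ :=
  (eLpNorm f 2 μ).toReal

variable {D : Type*} [MeasurableSpace D] (μ : Measure D)
  (H : Type*) [NormedAddCommGroup H] [InnerProductSpace ℂ H] [RKHS ℂ H D ℂ]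

/-- The set of all quotients `‖f‖₂² / ‖f‖_H²` with `0 ≠ f ∈ H`. -/
def embeddingQuotients : Set ℝ :=
  {q | ∃ f : H, f ≠ 0 ∧ q = l2Norm μ f ^ 2 / ‖f‖ ^ 2}

/-- `λ = sup_{0 ≠ f ∈ H} ‖f‖₂² / ‖f‖_H²`, the squared norm of the embedding of `H` in `L₂`. -/
def embeddingConst : ℝ := sSup (embeddingQuotients μ H)

/-- The diagonal `x ↦ K(x,x)` (a nonnegative real number) of the reproducing kernel of a
complex-valued reproducing kernel Hilbert space. In Mathlib the kernel takes values in the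
continuous linear maps `ℂ → ℂ`, which are identified with scalars by evaluation at `1`. -/
def kernelDiag [CompleteSpace H] (x : D) : ℝ := (RKHS.kernel H x x 1).re

/-- `Tr(K) = ∫ K(x,x) dμ(x)`; meaningful if the diagonal of the kernel is integrable. -/
def kernelTrace [CompleteSpace H] : ℝ := ∫ x, kernelDiag H x ∂μ

/-- The effective dimension `M = Tr(K) / λ` of `H` in `L₂(D,μ)`. -/
def effectiveDim [CompleteSpace H] : ℝ := kernelTrace μ H / embeddingConst μ H

end NormDiscretization

end

open MeasureTheory

noncomputable section

namespace NormDiscretization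

open InnerProductSpace

/-! ### Positive operators, rank-one updates and resolvents -/

section Operators

variable {E : Type*} [NormedAddCommGroup E] [InnerProductSpace ℂ E]

/-! The proof is a two-sided barrier argument in the style of Batson, Spielman and Srivastava. Both
inequalities become bounds on sums of rank-one operators: `B = ∑ w_i k(x_i) ⊗ k(x_i) ≤ (1 +
√(M/n))²` on a Hilbert space `E`, and `A = ∑ w_i v(x_i) ⊗ v(x_i) ≥ (1 - √((d-1)/n))²` on `ℂ^d`. Here
`v` comes from an orthonormal basis of the image of `V` in `L₂`, so that `∫ v ⊗ v = 1` and `d ≤ m`.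

The bound on `∑ w_i` is built into the first inequality by taking `E = H ⊕ ℂ` and `k(x) = (λ^(-1/2)
K_x, 1)`. The mean-zero condition decouples the two coordinates, so `W = ∫ k ⊗ k` satisfies `W ≤ 1`,
while its trace is `M + 1`.

Points are added one at a time. After `j` steps `X = b + j a W - B` and `Y = A + β - j α` are
strictly positive, and the potentials `tr(W X⁻¹)` and `tr(Y⁻¹)` do not exceed their initial values.
A weight `w` at `y` preserves the upper state if `w U(y) ≤ 1` (`exists_upper_barrier_step`) and the
lower state if `w L(y) ≥ 1` (`exists_lower_barrier_step`). The constants give `∫ U ≤ n ≤ ∫ L`, so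
some `y` has `U(y) ≤ L(y)` and one weight serves both (`exists_points_of_barriers`).

At the end, `frameOp_le_smul` converts the bounded potentials into a definite gap between the sums
and their barriers. This gain replaces `M + 1` and `d` by `M` and `d - 1`. -/

theorem re_inner_real_smul_right (t : ℝ) (x y : E) :
    (inner ℂ x (t • y)).re = t * (inner ℂ x y).re := by
  rw [← Complex.coe_smul, inner_smul_right, Complex.re_ofReal_mul]

theorem re_inner_rankOne_self (k e : E) :
    (inner ℂ e (rankOne ℂ k k e)).re = ‖inner ℂ k e‖ ^ 2 := by
  rw [rankOne_apply, inner_smul_right, ← inner_conj_symm e k, Complex.mul_conj,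
    Complex.normSq_eq_norm_sq, Complex.ofReal_re]

theorem rankOne_self_nonneg (k : E) : 0 ≤ rankOne ℂ k k :=
  (ContinuousLinearMap.nonneg_iff_isPositive _).2 (isPositive_rankOne_self k)

theorem apply_inverse_apply {X : E →L[ℂ] E} (hX : IsUnit X) (e : E) :
    X (Ring.inverse X e) = e :=
  DFunLike.congr_fun (Ring.mul_inverse_cancel X hX) e

variable [CompleteSpace E]

theorem nonneg_iff_isSelfAdjoint_and_re_inner {T : E →L[ℂ] E} :
    0 ≤ T ↔ IsSelfAdjoint T ∧ ∀ e, 0 ≤ (inner ℂ e (T e)).re := by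
  rw [ContinuousLinearMap.nonneg_iff_isPositive]
  constructor
  · exact fun h => ⟨h.isSelfAdjoint, fun e => h.re_inner_nonneg_right e⟩
  · rintro ⟨h, h'⟩
    rw [ContinuousLinearMap.isPositive_def']
    refine ⟨h, fun e => ?_⟩
    rw [ContinuousLinearMap.reApplyInnerSelf_apply, ← inner_re_symm]
    exact h' e

theorem re_inner_le_of_le {S T : E →L[ℂ] E} (h : S ≤ T) (e : E) :
    (inner ℂ e (S e)).re ≤ (inner ℂ e (T e)).re := by
  have := (nonneg_iff_isSelfAdjoint_and_re_inner.1 (sub_nonneg.2 h)).2 e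
  simpa [inner_sub_right] using this

theorem le_of_re_inner_le {S T : E →L[ℂ] E} (hS : IsSelfAdjoint S) (hT : IsSelfAdjoint T)
    (h : ∀ e, (inner ℂ e (S e)).re ≤ (inner ℂ e (T e)).re) : S ≤ T := by
  rw [← sub_nonneg, nonneg_iff_isSelfAdjoint_and_re_inner]
  refine ⟨hT.sub hS, fun e => ?_⟩
  simpa [inner_sub_right] using h e

theorem re_inner_nonneg {T : E →L[ℂ] E} (hT : 0 ≤ T) (e : E) : 0 ≤ (inner ℂ e (T e)).re :=
  (nonneg_iff_isSelfAdjoint_and_re_inner.1 hT).2 e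

theorem inner_apply_left_of_isSelfAdjoint {T : E →L[ℂ] E} (hT : IsSelfAdjoint T) (e f : E) :
    inner ℂ (T e) f = inner ℂ e (T f) := by
  rw [← ContinuousLinearMap.adjoint_inner_right, hT.adjoint_eq]

theorem isSelfAdjoint_real_smul {T : E →L[ℂ] E} (hT : IsSelfAdjoint T) (t : ℝ) :
    IsSelfAdjoint (t • T) := by
  rw [isSelfAdjoint_iff, star_smul, hT.star_eq, star_trivial]

theorem real_smul_nonneg {T : E →L[ℂ] E} (hT : 0 ≤ T) {t : ℝ} (ht : 0 ≤ t) : 0 ≤ t • T := by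
  rw [nonneg_iff_isSelfAdjoint_and_re_inner] at hT ⊢
  refine ⟨isSelfAdjoint_real_smul hT.1 t, fun e => ?_⟩
  rw [smul_apply, re_inner_real_smul_right]
  exact mul_nonneg ht (hT.2 e)

theorem isStrictlyPositive_real_smul {T : E →L[ℂ] E} (hT : IsStrictlyPositive T) {t : ℝ}
    (ht : 0 < t) : IsStrictlyPositive (t • T) := by
  rw [IsStrictlyPositive.iff_of_unital]
  refine ⟨real_smul_nonneg hT.nonneg ht.le, ?_⟩
  have := (hT.isUnit).smul (Units.mk0 t ht.ne')
  exact this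

theorem isSelfAdjoint_rankOne_self (k : E) : IsSelfAdjoint (rankOne ℂ k k) :=
  (isPositive_rankOne_self k).isSelfAdjoint

/-- Cauchy–Schwarz for the semi-inner product defined by `T`, obtained by moving one square root of
`T` to the left. -/
theorem norm_inner_apply_sq_le {T : E →L[ℂ] E} (hT : 0 ≤ T) (e f : E) :
    ‖inner ℂ e (T f)‖ ^ 2 ≤ (inner ℂ e (T e)).re * (inner ℂ f (T f)).re := by
  have hs : IsSelfAdjoint (CFC.sqrt T) := .of_nonneg (CFC.sqrt_nonneg T)
  have key : ∀ a b : E, inner ℂ a (T b) = inner ℂ (CFC.sqrt T a) (CFC.sqrt T b) := by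
    intro a b
    rw [inner_apply_left_of_isSelfAdjoint hs]
    exact congrArg _ (DFunLike.congr_fun (CFC.sqrt_mul_sqrt_self T hT) b).symm
  have key' : ∀ a : E, (inner ℂ a (T a)).re = ‖CFC.sqrt T a‖ ^ 2 := by
    intro a
    rw [key]
    exact inner_self_eq_norm_sq (𝕜 := ℂ) _
  rw [key, key', key', ← mul_pow]
  gcongr
  exact norm_inner_le_norm _ _

theorem norm_inner_sq_le_inverse {X : E →L[ℂ] E} (hX : IsStrictlyPositive X) (k e : E) :
    ‖inner ℂ k e‖ ^ 2 ≤ (inner ℂ k (Ring.inverse X k)).re * (inner ℂ e (X e)).re := by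
  have h := norm_inner_apply_sq_le hX.nonneg (Ring.inverse X k) e
  have hs : IsSelfAdjoint X := .of_nonneg hX.nonneg
  have hs' : IsSelfAdjoint (Ring.inverse X) := .of_nonneg hX.ringInverse.nonneg
  rwa [← inner_apply_left_of_isSelfAdjoint hs, apply_inverse_apply hX.isUnit,
    inner_apply_left_of_isSelfAdjoint hs'] at h

/-- The Sherman–Morrison formula. -/
theorem inverse_add_rankOne {X : E →L[ℂ] E} (hX : IsStrictlyPositive X) (k : E) (t : ℝ)
    (ht : 1 + t * (inner ℂ k (Ring.inverse X k)).re ≠ 0)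
    (hu : IsUnit (X + t • rankOne ℂ k k)) :
    Ring.inverse (X + t • rankOne ℂ k k) = Ring.inverse X -
      (t / (1 + t * (inner ℂ k (Ring.inverse X k)).re)) •
        rankOne ℂ (Ring.inverse X k) (Ring.inverse X k) := by
  have hs' : IsSelfAdjoint (Ring.inverse X) := .of_nonneg hX.ringInverse.nonneg
  set q := (inner ℂ k (Ring.inverse X k)).re with hq
  have hqc : inner ℂ k (Ring.inverse X k) = (q : ℂ) := by
    rw [hq, Complex.ext_iff]
    refine ⟨by simp, ?_⟩
    have : (starRingEnd ℂ) (inner ℂ k (Ring.inverse X k)) = inner ℂ k (Ring.inverse X k) := by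
      rw [inner_conj_symm, inner_apply_left_of_isSelfAdjoint hs']
    simpa using Complex.conj_eq_iff_im.1 this
  have h1 : (X + t • rankOne ℂ k k) * (Ring.inverse X - (t / (1 + t * q)) •
      rankOne ℂ (Ring.inverse X k) (Ring.inverse X k)) = 1 := by
    ext e
    change X (Ring.inverse X e - (t / (1 + t * q)) •
        inner ℂ (Ring.inverse X k) e • Ring.inverse X k) +
      t • inner ℂ k (Ring.inverse X e - (t / (1 + t * q)) •
        inner ℂ (Ring.inverse X k) e • Ring.inverse X k) • k = e
    simp only [map_sub, apply_inverse_apply hX.isUnit, inner_sub_right, ← Complex.coe_smul,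
      map_smul, inner_smul_right, hqc, inner_apply_left_of_isSelfAdjoint hs']
    have htc : (1 + (t : ℂ) * q) ≠ 0 := by exact_mod_cast ht
    set c := inner ℂ k (Ring.inverse X e)
    have : (t : ℂ) * (c - ((t / (1 + t * q) : ℝ) : ℂ) * (c * q)) -
        ((t / (1 + t * q) : ℝ) : ℂ) * c = 0 := by
      push_cast
      field_simp
      ring
    rw [smul_smul, smul_smul, sub_add_eq_add_sub, add_sub_assoc, ← sub_smul, this, zero_smul,
      add_zero]
  calc Ring.inverse (X + t • rankOne ℂ k k) = Ring.inverse (X + t • rankOne ℂ k k) *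
      ((X + t • rankOne ℂ k k) * (Ring.inverse X - (t / (1 + t * q)) •
      rankOne ℂ (Ring.inverse X k) (Ring.inverse X k))) := by rw [h1, mul_one]
    _ = _ := by rw [← mul_assoc, Ring.inverse_mul_cancel _ hu, one_mul]

/-- Resolvent comparison after increasing a strictly positive operator by `P`. -/
theorem mul_mul_le_inverse_sub {X P : E →L[ℂ] E} (hX : IsStrictlyPositive X) (hP : 0 ≤ P) :
    Ring.inverse (X + P) * P * Ring.inverse (X + P) ≤ Ring.inverse X - Ring.inverse (X + P) := by
  have hX' : IsStrictlyPositive (X + P) := hX.of_le (le_add_of_nonneg_right hP)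
  have hPs : IsSelfAdjoint P := .of_nonneg hP
  have hs' : IsSelfAdjoint (Ring.inverse (X + P)) := .of_nonneg hX'.ringInverse.nonneg
  set R := Ring.inverse X with hR
  set R' := Ring.inverse (X + P) with hR'
  have e1 : R - R' = R * P * R' := by
    calc R - R' = R * ((X + P) * R') - (R * X) * R' := by
          rw [Ring.mul_inverse_cancel _ hX'.isUnit, Ring.inverse_mul_cancel _ hX.isUnit, mul_one,
            one_mul]
      _ = R * P * R' := by noncomm_ring
  have e2 : R - R' = R' * P * R := by
    calc R - R' = (R' * (X + P)) * R - R' * (X * R) := by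
          rw [Ring.mul_inverse_cancel _ hX.isUnit, Ring.inverse_mul_cancel _ hX'.isUnit, mul_one,
            one_mul]
      _ = R' * P * R := by noncomm_ring
  -- Inserting one resolvent identity into the other leaves a congruence of `R ≥ 0`.
  have e3 : R - R' - R' * P * R' = star (P * R') * R * (P * R') := by
    rw [star_mul, hPs.star_eq, hs'.star_eq]
    calc R - R' - R' * P * R' = R' * P * (R - R') := by
          rw [mul_sub, ← e2]
      _ = _ := by rw [e1]; noncomm_ring
  rw [← sub_nonneg, e3]
  exact star_left_conjugate_nonneg hX.ringInverse.nonneg _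

end Operators

/-! ### Frame operators and traces against them -/

section FrameTrace

variable {D : Type*} [MeasurableSpace D] {μ : Measure D}
  {E : Type*} [NormedAddCommGroup E] [InnerProductSpace ℂ E]

/-- The trace of `T ∘ ∫ k(x) ⊗ k(x) dμ(x)`, written as an integral along the family `k`. -/
def frameTrace (μ : Measure D) (k : D → E) (T : E →L[ℂ] E) : ℝ :=
  ∫ x, (inner ℂ (k x) (T (k x))).re ∂μ

/-- The frame operator `∫ k(x) ⊗ k(x) dμ(x)`. -/
def frameOp (μ : Measure D) (k : D → E) : E →L[ℂ] E :=
  ∫ x, rankOne ℂ (k x) (k x) ∂μ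

variable {k : D → E}

theorem integrable_inner_of_memLp {f g : D → E} (hf : MemLp f 2 μ) (hg : MemLp g 2 μ) :
    Integrable (fun x => inner ℂ (f x) (g x)) μ := by
  refine Integrable.mono' (hf.norm.integrable_mul hg.norm)
    (hf.aestronglyMeasurable.inner hg.aestronglyMeasurable) (.of_forall fun x => ?_)
  exact norm_inner_le_norm _ _

theorem integrable_inner_apply (hk : MemLp k 2 μ) (T : E →L[ℂ] E) :
    Integrable (fun x => (inner ℂ (k x) (T (k x))).re) μ :=
  (integrable_inner_of_memLp hk (T.comp_memLp' hk)).re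

theorem frameTrace_add (hk : MemLp k 2 μ) (S T : E →L[ℂ] E) :
    frameTrace μ k (S + T) = frameTrace μ k S + frameTrace μ k T := by
  simp only [frameTrace, add_apply, inner_add_right, Complex.add_re]
  exact integral_add (integrable_inner_apply hk S) (integrable_inner_apply hk T)

theorem frameTrace_sub (hk : MemLp k 2 μ) (S T : E →L[ℂ] E) :
    frameTrace μ k (S - T) = frameTrace μ k S - frameTrace μ k T := by
  simp only [frameTrace, sub_apply, inner_sub_right, Complex.sub_re]
  exact integral_sub (integrable_inner_apply hk S) (integrable_inner_apply hk T)

theorem frameTrace_smul (t : ℝ) (T : E →L[ℂ] E) :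
    frameTrace μ k (t • T) = t * frameTrace μ k T := by
  simp only [frameTrace, smul_apply, re_inner_real_smul_right]
  exact integral_const_mul _ _

theorem frameTrace_one : frameTrace μ k 1 = ∫ x, ‖k x‖ ^ 2 ∂μ := by
  refine integral_congr_ae (.of_forall fun x => ?_)
  exact inner_self_eq_norm_sq (𝕜 := ℂ) (k x)

theorem continuous_rankOne_self : Continuous fun e : E => rankOne ℂ e e := by
  have h : Continuous fun e : E => (innerSL ℂ e).smulRight e := by fun_prop
  exact h

theorem integrable_rankOne (hk : MemLp k 2 μ) :
    Integrable (fun x => rankOne ℂ (k x) (k x)) μ := by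
  refine Integrable.mono' (hk.norm.integrable_mul hk.norm)
    (continuous_rankOne_self.comp_aestronglyMeasurable hk.aestronglyMeasurable)
    (.of_forall fun x => ?_)
  exact (norm_rankOne (k x) (k x)).le

variable [CompleteSpace E]

theorem frameTrace_mono (hk : MemLp k 2 μ) {S T : E →L[ℂ] E} (h : S ≤ T) :
    frameTrace μ k S ≤ frameTrace μ k T :=
  integral_mono (integrable_inner_apply hk S) (integrable_inner_apply hk T)
    fun x => re_inner_le_of_le h (k x)

theorem frameTrace_nonneg {T : E →L[ℂ] E} (hT : 0 ≤ T) : 0 ≤ frameTrace μ k T :=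
  integral_nonneg fun x => re_inner_nonneg hT (k x)

theorem re_inner_frameOp (hk : MemLp k 2 μ) (e : E) :
    (inner ℂ e (frameOp μ k e)).re = ∫ x, ‖inner ℂ (k x) e‖ ^ 2 ∂μ := by
  let ℓ : (E →L[ℂ] E) →L[ℂ] ℂ := (innerSL ℂ e) ∘L (ContinuousLinearMap.apply ℂ E e)
  have h1 : inner ℂ e (frameOp μ k e) = ∫ x, ℓ (rankOne ℂ (k x) (k x)) ∂μ := by
    rw [ContinuousLinearMap.integral_comp_comm ℓ (integrable_rankOne hk)]
    rfl
  have h2 := ℓ.integrable_comp (integrable_rankOne hk)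
  rw [h1, ← Complex.reCLM_apply, ← ContinuousLinearMap.integral_comp_comm _ h2]
  refine integral_congr_ae (.of_forall fun x => ?_)
  exact re_inner_rankOne_self (k x) e

theorem frameOp_nonneg (hk : MemLp k 2 μ) : 0 ≤ frameOp μ k := by
  rw [nonneg_iff_isSelfAdjoint_and_re_inner]
  refine ⟨?_, fun e => ?_⟩
  · rw [isSelfAdjoint_iff, frameOp]
    have h := ((starL' ℝ : (E →L[ℂ] E) ≃L[ℝ] (E →L[ℂ] E)) :
      (E →L[ℂ] E) →L[ℝ] (E →L[ℂ] E)).integral_comp_comm (integrable_rankOne hk)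
    refine h.symm.trans (integral_congr_ae (.of_forall fun x => ?_))
    exact (isSelfAdjoint_rankOne_self (k x)).star_eq
  · rw [re_inner_frameOp hk]
    positivity

/-- This replaces cyclicity of the trace; it evaluates the Sherman–Morrison correction. -/
theorem frameTrace_rankOne (hk : MemLp k 2 μ) (e : E) :
    frameTrace μ k (rankOne ℂ e e) = (inner ℂ e (frameOp μ k e)).re := by
  rw [re_inner_frameOp hk]
  refine integral_congr_ae (.of_forall fun x => ?_)
  simp only [re_inner_rankOne_self]
  rw [norm_inner_symm]

/-- Integrating `|⟨k(x), e⟩|² ≤ ⟨k(x), X⁻¹ k(x)⟩ ⟨e, X e⟩` suffices. A bound on the potential thus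
keeps the barrier at a distance. -/
theorem frameOp_le_smul (hk : MemLp k 2 μ) {X : E →L[ℂ] E} (hX : IsStrictlyPositive X) :
    frameOp μ k ≤ frameTrace μ k (Ring.inverse X) • X := by
  refine le_of_re_inner_le (.of_nonneg (frameOp_nonneg hk))
    (isSelfAdjoint_real_smul (.of_nonneg hX.nonneg) _) fun e => ?_
  rw [re_inner_frameOp hk, smul_apply, re_inner_real_smul_right, frameTrace, ← integral_mul_const]
  refine integral_mono_of_nonneg (.of_forall fun x => by positivity)
    ((integrable_inner_apply hk _).mul_const _) (.of_forall fun x => ?_)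
  exact norm_inner_sq_le_inverse hX (k x) e

end FrameTrace

/-! ### One step of the upper barrier -/

section UpperBarrier

variable {D : Type*} [MeasurableSpace D] {μ : Measure D} [IsProbabilityMeasure μ]
  {E : Type*} [NormedAddCommGroup E] [InnerProductSpace ℂ E] [CompleteSpace E] {k : D → E}

/-- One step of the upper barrier argument: the barrier `X = U - B` is raised by a multiple of the
frame operator, after which a rank-one term of small enough weight can be subtracted without
increasing the potential `frameTrace μ k X⁻¹`. -/
theorem exists_upper_barrier_step (hk : MemLp k 2 μ) (hk0 : ∀ x, k x ≠ 0)
    (hpos : ∀ e : E, e ≠ 0 → 0 < (inner ℂ e (frameOp μ k e)).re)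
    {X : E →L[ℂ] E} (hX : IsStrictlyPositive X) {a : ℝ} (ha : 0 < a) :
    ∃ U : D → ℝ, Integrable U μ ∧ (∀ y, 0 < U y) ∧
      ∫ y, U y ∂μ ≤ 1 / a + frameTrace μ k (Ring.inverse X) ∧
      ∀ y w, 0 < w → w * U y ≤ 1 →
        IsStrictlyPositive (X + a • frameOp μ k - w • rankOne ℂ (k y) (k y)) ∧
        frameTrace μ k (Ring.inverse (X + a • frameOp μ k - w • rankOne ℂ (k y) (k y))) ≤
          frameTrace μ k (Ring.inverse X) := by
  have hP : 0 ≤ a • frameOp μ k := real_smul_nonneg (frameOp_nonneg hk) ha.le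
  have hX' : IsStrictlyPositive (X + a • frameOp μ k) := hX.of_le (le_add_of_nonneg_right hP)
  have hcmp := mul_mul_le_inverse_sub hX hP
  set W := frameOp μ k with hW
  set X' := X + a • W with hX'def
  set R' := Ring.inverse X' with hR'
  have hR's : IsSelfAdjoint R' := .of_nonneg hX'.ringInverse.nonneg
  have hRk : ∀ y, R' (k y) ≠ 0 := fun y h => hk0 y <| by
    rw [← apply_inverse_apply hX'.isUnit (k y), ← hR', h, map_zero]
  have hs : ∀ y, (inner ℂ (k y) ((R' * W * R') (k y))).re
      = (inner ℂ (R' (k y)) (W (R' (k y)))).re := fun y => by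
    rw [inner_apply_left_of_isSelfAdjoint hR's]; rfl
  have hspos : ∀ y, 0 < (inner ℂ (k y) ((R' * W * R') (k y))).re := fun y => by
    rw [hs]; exact hpos _ (hRk y)
  have hq : ∀ y, 0 ≤ (inner ℂ (k y) (R' (k y))).re := fun y =>
    re_inner_nonneg hX'.ringInverse.nonneg _
  set S := frameTrace μ k (R' * W * R') with hS
  have hSpos : 0 < S := by
    rw [hS, frameTrace, integral_pos_iff_support_of_nonneg (fun y => (hspos y).le)
      (integrable_inner_apply hk _)]
    have : Function.support (fun y => (inner ℂ (k y) ((R' * W * R') (k y))).re) = Set.univ :=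
      Set.eq_univ_of_forall fun y => (hspos y).ne'
    rw [this, measure_univ]
    exact one_pos
  have hΔ : a * S ≤ frameTrace μ k (Ring.inverse X) - frameTrace μ k R' := by
    rw [← frameTrace_sub hk, hS, ← frameTrace_smul]
    refine frameTrace_mono hk ?_
    rwa [mul_smul_comm, smul_mul_assoc] at hcmp
  have haS : 0 < a * S := mul_pos ha hSpos
  -- Raising the barrier lowers the potential by at least `a * S`. By Sherman–Morrison, subtracting
  -- the rank-one term raises it by `w s / (1 - w q)`, and `w * U y ≤ 1` says exactly that this is
  -- at most `a * S`. Since the barrier moves along `W`, the mean of `s` is the same `S`, which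
  -- leaves `1 / a`.
  refine ⟨fun y => (inner ℂ (k y) ((R' * W * R') (k y))).re / (a * S) +
    (inner ℂ (k y) (R' (k y))).re, ?_, ?_, ?_, ?_⟩
  · exact ((integrable_inner_apply hk _).div_const _).add (integrable_inner_apply hk _)
  · exact fun y => add_pos_of_pos_of_nonneg (div_pos (hspos y) haS) (hq y)
  · rw [integral_add ((integrable_inner_apply hk _).div_const _) (integrable_inner_apply hk _),
      integral_div]
    change S / (a * S) + frameTrace μ k R' ≤ _
    rw [div_mul_cancel_right₀ hSpos.ne', one_div]
    linarith
  · intro y w hw hwU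
    set s := (inner ℂ (k y) ((R' * W * R') (k y))).re with hsdef
    set q := (inner ℂ (k y) (R' (k y))).re with hqdef
    have hs0 : 0 < s := hspos y
    have h1 : w * s ≤ (1 - w * q) * (a * S) := by
      have : w * (s / (a * S)) ≤ 1 - w * q := by linarith
      rwa [← mul_div_assoc, div_le_iff₀ haS] at this
    have hwq : 0 < 1 - w * q := by
      by_contra! h
      have := mul_nonpos_of_nonpos_of_nonneg h haS.le
      have := mul_pos hw hs0
      linarith
    have hrank : w • rankOne ℂ (k y) (k y) ≤ (w * q) • X' := by
      refine le_of_re_inner_le (isSelfAdjoint_real_smul (isSelfAdjoint_rankOne_self _) _)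
        (isSelfAdjoint_real_smul (.of_nonneg hX'.nonneg) _) fun e => ?_
      rw [smul_apply, smul_apply, re_inner_real_smul_right, re_inner_real_smul_right,
        re_inner_rankOne_self, mul_assoc]
      exact mul_le_mul_of_nonneg_left (norm_inner_sq_le_inverse hX' _ _) hw.le
    have hX'' : IsStrictlyPositive (X' - w • rankOne ℂ (k y) (k y)) := by
      refine (isStrictlyPositive_real_smul hX' hwq).of_le ?_
      rw [sub_smul, one_smul]
      exact sub_le_sub_left hrank _
    refine ⟨hX'', ?_⟩
    have hform : X' - w • rankOne ℂ (k y) (k y) = X' + (-w) • rankOne ℂ (k y) (k y) := by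
      rw [neg_smul, sub_eq_add_neg]
    rw [hform] at hX'' ⊢
    rw [inverse_add_rankOne hX' (k y) (-w) (by rw [neg_mul, ← sub_eq_add_neg]; exact hwq.ne')
      hX''.isUnit, frameTrace_sub hk, frameTrace_smul, frameTrace_rankOne hk, ← hR', ← hW, ← hs y,
      ← hsdef, ← hqdef]
    have : w / (1 - w * q) * s ≤ a * S := by
      rw [div_mul_eq_mul_div, div_le_iff₀ hwq]; linarith
    have e : -w / (1 + -w * q) * s = - (w / (1 - w * q) * s) := by
      rw [neg_mul, ← sub_eq_add_neg, neg_div, neg_mul]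
    rw [e]
    linarith

end UpperBarrier

/-! ### One step of the lower barrier -/

section LowerBarrier

variable {D : Type*} [MeasurableSpace D] {μ : Measure D}
  {E : Type*} [NormedAddCommGroup E] [InnerProductSpace ℂ E] [CompleteSpace E] {v : D → E}

/-- Cauchy–Schwarz for the trace, in the form of a quadratic in `t`: expand the positive operator
`(1 - t T) R (1 - t T)`. -/
theorem frameTrace_mul_sq_le (hv : MemLp v 2 μ) {R T : E →L[ℂ] E} (hR : 0 ≤ R)
    (hT : IsSelfAdjoint T) (hRT : R * T = T * R) (t : ℝ) :
    2 * t * frameTrace μ v (R * T) ≤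
      frameTrace μ v R + t ^ 2 * frameTrace μ v (T * R * T) := by
  have h1 : 0 ≤ (1 - t • T) * R * (1 - t • T) :=
    IsSelfAdjoint.conjugate_nonneg hR ((IsSelfAdjoint.one _).sub (isSelfAdjoint_real_smul hT t))
  have h2 : (1 - t • T) * R * (1 - t • T) = R - (2 * t) • (R * T) + (t ^ 2) • (T * R * T) := by
    simp only [sub_mul, mul_sub, one_mul, mul_one, smul_mul_assoc, mul_smul_comm, ← hRT]
    module
  have h3 := frameTrace_nonneg (μ := μ) (k := v) h1
  rw [h2, frameTrace_add hv, frameTrace_sub hv, frameTrace_smul, frameTrace_smul] at h3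
  linarith

/-- One step of the lower barrier argument: the barrier `Y = A - ℓ` is lowered by a multiple of the
identity, after which adding a rank-one term of large enough weight brings the potential
`frameTrace μ v Y⁻¹` back below its former value. -/
theorem exists_lower_barrier_step (hv : MemLp v 2 μ) (hv1 : frameOp μ v = 1)
    (hv0 : 0 < ∫ x, ‖v x‖ ^ 2 ∂μ)
    {Y : E →L[ℂ] E} (hY : IsStrictlyPositive Y) {a : ℝ} (ha : 0 < a)
    (hYa : a * frameTrace μ v (Ring.inverse Y) < 1) :
    ∃ L : D → ℝ, Integrable L μ ∧
      1 / a - frameTrace μ v (Ring.inverse Y) ≤ ∫ y, L y ∂μ ∧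
      ∀ y w, 0 < w → 1 ≤ w * L y →
        IsStrictlyPositive (Y - a • (1 : E →L[ℂ] E) + w • rankOne ℂ (v y) (v y)) ∧
        frameTrace μ v (Ring.inverse (Y - a • (1 : E →L[ℂ] E) + w • rankOne ℂ (v y) (v y))) ≤
          frameTrace μ v (Ring.inverse Y) := by
  set R := Ring.inverse Y with hR
  have hRpos : IsStrictlyPositive R := hY.ringInverse
  set ε := frameTrace μ v R with hε
  have hYle : 1 ≤ ε • Y := hv1 ▸ frameOp_le_smul hv hY
  have hY' : IsStrictlyPositive (Y - a • (1 : E →L[ℂ] E)) := by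
    refine (isStrictlyPositive_real_smul hY (sub_pos.2 hYa)).of_le ?_
    have h := real_smul_nonneg (sub_nonneg.2 hYle) ha.le
    rw [← sub_nonneg]
    convert h using 1
    module
  set Y' := Y - a • (1 : E →L[ℂ] E) with hY'def
  have hYY' : Y = Y' + a • (1 : E →L[ℂ] E) := by rw [hY'def]; abel
  set R' := Ring.inverse Y' with hR'
  have hR'pos : IsStrictlyPositive R' := hY'.ringInverse
  have hRs : IsSelfAdjoint R := .of_nonneg hRpos.nonneg
  have hR's : IsSelfAdjoint R' := .of_nonneg hR'pos.nonneg
  have e1 : R' - R = a • (R * R') := by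
    calc R' - R = (R * Y) * R' - R * (Y' * R') := by
          rw [hR, hR', Ring.mul_inverse_cancel _ hY'.isUnit, Ring.inverse_mul_cancel _ hY.isUnit,
            mul_one, one_mul]
      _ = R * (a • (1 : E →L[ℂ] E)) * R' := by rw [hYY']; noncomm_ring
      _ = _ := by rw [mul_smul_comm, mul_one, smul_mul_assoc]
  have e2 : R' - R = a • (R' * R) := by
    calc R' - R = R' * (Y * R) - (R' * Y') * R := by
          rw [hR, hR', Ring.mul_inverse_cancel _ hY.isUnit, Ring.inverse_mul_cancel _ hY'.isUnit,
            mul_one, one_mul]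
      _ = R' * (a • (1 : E →L[ℂ] E)) * R := by rw [hYY']; noncomm_ring
      _ = _ := by rw [mul_smul_comm, mul_one, smul_mul_assoc]
  have hcomm : R * R' = R' * R := by
    have h := e1.symm.trans e2
    exact smul_right_injective _ ha.ne' h
  have e3 : R' * R' - R * R' = a • (R' * R * R') := by
    rw [← sub_mul, e2, smul_mul_assoc]
  set Δ := frameTrace μ v R' - ε with hΔ
  set T₁ := frameTrace μ v (R * R')
  set T₂ := frameTrace μ v (R' * R * R')
  set S := frameTrace μ v (R' * R') with hS
  have hΔT : Δ = a * T₁ := by rw [hΔ, hε, ← frameTrace_sub hv, e1, frameTrace_smul]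
  have hST : S - T₁ = a * T₂ := by rw [hS, ← frameTrace_sub hv, e3, frameTrace_smul]
  have hCS : ∀ t : ℝ, 2 * t * T₁ ≤ ε + t ^ 2 * T₂ := fun t =>
    frameTrace_mul_sq_le hv hRpos.nonneg hR's hcomm t
  have hΔpos : 0 < Δ := by
    have h1 : R * (a • (1 : E →L[ℂ] E)) * R ≤ R' - R := by
      have h := mul_mul_le_inverse_sub hY' (real_smul_nonneg (zero_le_one) ha.le)
      rwa [← hYY'] at h
    have h2 := frameTrace_mono hv h1
    rw [frameTrace_sub hv, mul_smul_comm, mul_one, smul_mul_assoc, frameTrace_smul] at h2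
    refine lt_of_lt_of_le (mul_pos ha ?_) h2
    have h3 : ∀ x, (inner ℂ (v x) ((R * R) (v x))).re = ‖R (v x)‖ ^ 2 := fun x => by
      have : inner ℂ (v x) ((R * R) (v x)) = inner ℂ (R (v x)) (R (v x)) := by
        rw [inner_apply_left_of_isSelfAdjoint hRs]; rfl
      rw [this]
      exact inner_self_eq_norm_sq (𝕜 := ℂ) _
    -- Since `v = Y R v`, the trace of `R²` cannot vanish, so the potential rises strictly.
    have h4 : ∫ x, ‖v x‖ ^ 2 ∂μ ≤ ‖Y‖ ^ 2 * frameTrace μ v (R * R) := by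
      rw [frameTrace, ← integral_const_mul]
      refine integral_mono_of_nonneg (.of_forall fun x => by positivity)
        ((integrable_inner_apply hv _).const_mul _) (.of_forall fun x => ?_)
      simp only [h3, ← mul_pow]
      gcongr
      calc ‖v x‖ = ‖Y (R (v x))‖ := by rw [hR, apply_inverse_apply hY.isUnit]
        _ ≤ _ := Y.le_opNorm _
    exact pos_of_mul_pos_right (hv0.trans_le h4) (by positivity)
  have hT₁pos : 0 < T₁ := pos_of_mul_pos_right (hΔT ▸ hΔpos) ha.le
  -- In terms of `T₁` and `T₂` this reads `a T₁² ≤ T₂`, a consequence of `T₁² ≤ ε T₂` and `a ε < 1`.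
  -- The choice `t = 1 / (a T₁)` avoids dividing by `T₂`.
  have hkey : Δ / a + Δ ^ 2 ≤ S := by
    have h := hCS (1 / (a * T₁))
    have h5 : a * T₁ ^ 2 ≤ T₂ := by
      have h6 : 2 * (1 / (a * T₁)) * T₁ = 2 / a := by field_simp
      have h7 : (1 / (a * T₁)) ^ 2 * T₂ = T₂ / (a ^ 2 * T₁ ^ 2) := by field_simp
      rw [h6, h7] at h
      have h8 : ε ≤ 1 / a := by rw [le_div_iff₀ ha]; linarith
      have h9 : 1 / a ≤ T₂ / (a ^ 2 * T₁ ^ 2) := by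
        have : 2 / a = 1 / a + 1 / a := by ring
        linarith
      rw [div_le_div_iff₀ ha (by positivity)] at h9
      nlinarith
    have h10 : Δ / a = T₁ := by rw [hΔT]; field_simp
    rw [h10, hΔT]
    nlinarith
  -- The rank-one term lowers the potential by `w s / (1 + w q)`, and `1 ≤ w * L y` says exactly
  -- that this compensates the rise `Δ`.
  refine ⟨fun y => (inner ℂ (v y) ((R' * R') (v y))).re / Δ - (inner ℂ (v y) (R' (v y))).re,
    ?_, ?_, ?_⟩
  · exact ((integrable_inner_apply hv _).div_const _).sub (integrable_inner_apply hv _)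
  · rw [integral_sub ((integrable_inner_apply hv _).div_const _) (integrable_inner_apply hv _),
      integral_div]
    change _ ≤ S / Δ - frameTrace μ v R'
    have : 1 / a + Δ ≤ S / Δ := by
      rw [le_div_iff₀ hΔpos]
      calc (1 / a + Δ) * Δ = Δ / a + Δ ^ 2 := by ring
        _ ≤ S := hkey
    linarith
  · intro y w hw hwL
    have hY'' : IsStrictlyPositive (Y' + w • rankOne ℂ (v y) (v y)) :=
      hY'.of_le (le_add_of_nonneg_right (real_smul_nonneg (rankOne_self_nonneg _) hw.le))
    refine ⟨hY'', ?_⟩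
    set q := (inner ℂ (v y) (R' (v y))).re with hq
    set s := (inner ℂ (v y) ((R' * R') (v y))).re with hs
    have hq0 : 0 ≤ q := re_inner_nonneg hR'pos.nonneg _
    have hwq : 0 < 1 + w * q := by positivity
    have hs' : (inner ℂ (R' (v y)) (frameOp μ v (R' (v y)))).re = s := by
      rw [hs, hv1, inner_apply_left_of_isSelfAdjoint hR's]; rfl
    rw [inverse_add_rankOne hY' (v y) w hwq.ne' hY''.isUnit, frameTrace_sub hv, frameTrace_smul,
      frameTrace_rankOne hv, ← hR', hs', ← hq]
    have h1 : (1 + w * q) * Δ ≤ w * s := by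
      have : 1 + w * q ≤ w * s / Δ := by
        rw [mul_sub, ← mul_div_assoc] at hwL; linarith
      rwa [le_div_iff₀ hΔpos] at this
    have h2 : Δ ≤ w / (1 + w * q) * s := by
      rw [div_mul_eq_mul_div, le_div_iff₀ hwq]; linarith
    linarith

end LowerBarrier

/-! ### Greedy selection and the barrier invariants -/

section Greedy

variable {D : Type*} [MeasurableSpace D] {μ : Measure D}
  {E F : Type*} [NormedAddCommGroup E] [InnerProductSpace ℂ E]
  [NormedAddCommGroup F] [InnerProductSpace ℂ F]

/-- Greedy selection of points and weights subject to an upper and a lower barrier condition. -/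
theorem exists_points_of_barriers [IsProbabilityMeasure μ] {k : D → E} {v : D → F} {s : Set D} (hs : μ sᶜ = 0) (c : ℝ)
    (PU : ℕ → (E →L[ℂ] E) → Prop) (PL : ℕ → (F →L[ℂ] F) → Prop) (hU0 : PU 0 0) (hL0 : PL 0 0)
    (hU : ∀ j B, PU j B → ∃ U : D → ℝ, Integrable U μ ∧ (∀ y, 0 < U y) ∧ ∫ y, U y ∂μ ≤ c ∧
      ∀ y w, 0 < w → w * U y ≤ 1 → PU (j + 1) (B + w • rankOne ℂ (k y) (k y)))
    (hL : ∀ j A, PL j A → ∃ L : D → ℝ, Integrable L μ ∧ c ≤ ∫ y, L y ∂μ ∧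
      ∀ y w, 0 < w → 1 ≤ w * L y → PL (j + 1) (A + w • rankOne ℂ (v y) (v y))) (n : ℕ) :
    ∃ (x : Fin n → D) (w : Fin n → ℝ), (∀ i, x i ∈ s) ∧ (∀ i, 0 < w i) ∧
      PU n (∑ i, w i • rankOne ℂ (k (x i)) (k (x i))) ∧
      PL n (∑ i, w i • rankOne ℂ (v (x i)) (v (x i))) := by
  induction n with
  | zero => exact ⟨Fin.elim0, Fin.elim0, fun i => i.elim0, fun i => i.elim0, by simpa, by simpa⟩
  | succ n ih =>
    obtain ⟨x, w, hxs, hw, hPU, hPL⟩ := ih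
    obtain ⟨U, hUi, hU0, hUc, hUstep⟩ := hU n _ hPU
    obtain ⟨L, hLi, hLc, hLstep⟩ := hL n _ hPL
    -- `U - L` has nonpositive mean, hence is nonpositive at some point outside the null set; the
    -- weight there is `1 / U y`.
    obtain ⟨y, hys, hy⟩ := exists_notMem_null_le_integral (hUi.sub hLi) hs
    have hUL : U y ≤ L y := by
      have h := integral_sub hUi hLi
      simp only [Pi.sub_apply] at hy
      linarith
    have hinv : 0 < (U y)⁻¹ := inv_pos.2 (hU0 y)
    refine ⟨Fin.snoc x y, Fin.snoc w (U y)⁻¹, ?_, ?_, ?_, ?_⟩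
    · intro i
      induction i using Fin.lastCases with
      | last => simpa using hys
      | cast i => simpa using hxs i
    · intro i
      induction i using Fin.lastCases with
      | last => simpa using hU0 y
      | cast i => simpa using hw i
    · rw [Fin.sum_univ_castSucc]
      simp only [Fin.snoc_castSucc, Fin.snoc_last]
      exact hUstep y _ hinv (inv_mul_cancel₀ (hU0 y).ne').le
    · rw [Fin.sum_univ_castSucc]
      simp only [Fin.snoc_castSucc, Fin.snoc_last]
      refine hLstep y _ hinv ?_
      rw [← inv_mul_cancel₀ (hU0 y).ne']
      gcongr

theorem re_inner_sum_rankOne {n : ℕ} (k : Fin n → E) (w : Fin n → ℝ) (e : E) :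
    (inner ℂ e ((∑ i, w i • rankOne ℂ (k i) (k i)) e)).re = ∑ i, w i * ‖inner ℂ (k i) e‖ ^ 2 := by
  rw [sum_apply, inner_sum, Complex.re_sum]
  refine Finset.sum_congr rfl fun i _ => ?_
  rw [smul_apply, re_inner_real_smul_right, re_inner_rankOne_self]

theorem inverse_smul_one {b : ℝ} (hb : b ≠ 0) :
    Ring.inverse (b • (1 : E →L[ℂ] E)) = b⁻¹ • (1 : E →L[ℂ] E) := by
  have hu : IsUnit (b • (1 : E →L[ℂ] E)) := isUnit_one.smul (Units.mk0 b hb)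
  calc Ring.inverse (b • (1 : E →L[ℂ] E)) =
        Ring.inverse (b • (1 : E →L[ℂ] E)) * ((b • (1 : E →L[ℂ] E)) * (b⁻¹ • 1)) := by
          rw [smul_mul_smul_comm, mul_inv_cancel₀ hb, one_smul, mul_one, mul_one]
    _ = _ := by rw [← mul_assoc, Ring.inverse_mul_cancel _ hu, one_mul]

variable [CompleteSpace E] [CompleteSpace F]

theorem isStrictlyPositive_smul_one {b : ℝ} (hb : 0 < b) :
    IsStrictlyPositive (b • (1 : E →L[ℂ] E)) :=
  isStrictlyPositive_real_smul isStrictlyPositive_one hb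

/-- State of the upper barrier: `b + j a W` lies above `B`, with controlled potential. -/
def UpperBarrier (μ : Measure D) (k : D → E) (a b : ℝ) (j : ℕ) (B : E →L[ℂ] E) : Prop :=
  IsStrictlyPositive (b • (1 : E →L[ℂ] E) + (j * a) • frameOp μ k - B) ∧
    frameTrace μ k (Ring.inverse (b • (1 : E →L[ℂ] E) + (j * a) • frameOp μ k - B)) ≤
      (∫ x, ‖k x‖ ^ 2 ∂μ) / b

theorem UpperBarrier.zero (k : D → E) (a : ℝ) {b : ℝ} (hb : 0 < b) :
    UpperBarrier μ k a b 0 0 := by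
  simp only [UpperBarrier, CharP.cast_eq_zero, zero_mul, zero_smul, add_zero, sub_zero]
  refine ⟨isStrictlyPositive_smul_one hb, ?_⟩
  rw [inverse_smul_one hb.ne', frameTrace_smul, frameTrace_one, inv_mul_eq_div]

theorem UpperBarrier.exists_step [IsProbabilityMeasure μ] {k : D → E} (hk : MemLp k 2 μ) (hk0 : ∀ x, k x ≠ 0)
    (hpos : ∀ e : E, e ≠ 0 → 0 < (inner ℂ e (frameOp μ k e)).re) {a b : ℝ} (ha : 0 < a)
    {j : ℕ} {B : E →L[ℂ] E} (h : UpperBarrier μ k a b j B) :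
    ∃ U : D → ℝ, Integrable U μ ∧ (∀ y, 0 < U y) ∧
      ∫ y, U y ∂μ ≤ 1 / a + (∫ x, ‖k x‖ ^ 2 ∂μ) / b ∧
      ∀ y w, 0 < w → w * U y ≤ 1 →
        UpperBarrier μ k a b (j + 1) (B + w • rankOne ℂ (k y) (k y)) := by
  obtain ⟨U, hUi, hU0, hUc, hU⟩ := exists_upper_barrier_step hk hk0 hpos h.1 ha
  refine ⟨U, hUi, hU0, hUc.trans (add_le_add_right h.2 _), fun y w hw hwU => ?_⟩
  have e : b • (1 : E →L[ℂ] E) + ((j + 1 : ℕ) * a) • frameOp μ k -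
      (B + w • rankOne ℂ (k y) (k y)) = b • (1 : E →L[ℂ] E) + (j * a) • frameOp μ k - B +
      a • frameOp μ k - w • rankOne ℂ (k y) (k y) := by
    push_cast
    module
  obtain ⟨h1, h2⟩ := hU y w hw hwU
  rw [UpperBarrier, e]
  exact ⟨h1, h2.trans h.2⟩

/-- The potential bound gives `X ≥ (b / M) W`, so `B ≤ b + (n a - b / M) W`. The coefficient of `W`
is nonnegative by `hab`, which permits `W ≤ 1`. Here `M` stands for the whole trace of `W`. -/
theorem UpperBarrier.re_inner_le {k : D → E} (hk : MemLp k 2 μ)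
    (hle : ∀ e : E, (inner ℂ e (frameOp μ k e)).re ≤ ‖e‖ ^ 2) {a b M : ℝ} (hb : 0 < b)
    (hM : ∫ x, ‖k x‖ ^ 2 ∂μ = M) (hM0 : 0 < M) {n : ℕ} (hab : b / M ≤ n * a)
    {B : E →L[ℂ] E} (h : UpperBarrier μ k a b n B) (e : E) :
    (inner ℂ e (B e)).re ≤ (b + n * a - b / M) * ‖e‖ ^ 2 := by
  obtain ⟨h1, h2⟩ := h
  rw [hM] at h2
  set X := b • (1 : E →L[ℂ] E) + (n * a) • frameOp μ k - B with hX
  have h3 := re_inner_le_of_le (frameOp_le_smul hk h1) e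
  rw [smul_apply, re_inner_real_smul_right] at h3
  have h4 := h3.trans (mul_le_mul_of_nonneg_right h2 (re_inner_nonneg h1.nonneg e))
  have h5 : (inner ℂ e (X e)).re =
      b * ‖e‖ ^ 2 + n * a * (inner ℂ e (frameOp μ k e)).re - (inner ℂ e (B e)).re := by
    have : (inner ℂ e e).re = ‖e‖ ^ 2 := inner_self_eq_norm_sq (𝕜 := ℂ) e
    rw [hX, sub_apply, add_apply, smul_apply, smul_apply, inner_sub_right, inner_add_right,
      Complex.sub_re, Complex.add_re, re_inner_real_smul_right, re_inner_real_smul_right, ← this]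
    rfl
  have h6 : b / M * (inner ℂ e (frameOp μ k e)).re ≤ (inner ℂ e (X e)).re := by
    calc b / M * (inner ℂ e (frameOp μ k e)).re ≤ b / M * (M / b * (inner ℂ e (X e)).re) := by
          gcongr
      _ = _ := by field_simp
  have h7 := mul_le_mul_of_nonneg_left (hle e) (sub_nonneg.2 hab)
  linarith

/-- State of the lower barrier: `A` lies above `j a - b`, with controlled potential. -/
def LowerBarrier (μ : Measure D) (v : D → F) (a b : ℝ) (j : ℕ) (A : F →L[ℂ] F) : Prop :=
  IsStrictlyPositive (A + (b - j * a) • (1 : F →L[ℂ] F)) ∧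
    frameTrace μ v (Ring.inverse (A + (b - j * a) • (1 : F →L[ℂ] F))) ≤
      (∫ x, ‖v x‖ ^ 2 ∂μ) / b

theorem LowerBarrier.zero (v : D → F) (a : ℝ) {b : ℝ} (hb : 0 < b) :
    LowerBarrier μ v a b 0 0 := by
  simp only [LowerBarrier, CharP.cast_eq_zero, zero_mul, zero_add, sub_zero]
  refine ⟨isStrictlyPositive_smul_one hb, ?_⟩
  rw [inverse_smul_one hb.ne', frameTrace_smul, frameTrace_one, inv_mul_eq_div]

theorem LowerBarrier.exists_step {v : D → F} (hv : MemLp v 2 μ) (hv1 : frameOp μ v = 1)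
    (hv0 : 0 < ∫ x, ‖v x‖ ^ 2 ∂μ) {a b : ℝ} (ha : 0 < a)
    (hab : a * ((∫ x, ‖v x‖ ^ 2 ∂μ) / b) < 1) {j : ℕ} {A : F →L[ℂ] F}
    (h : LowerBarrier μ v a b j A) :
    ∃ L : D → ℝ, Integrable L μ ∧ 1 / a - (∫ x, ‖v x‖ ^ 2 ∂μ) / b ≤ ∫ y, L y ∂μ ∧
      ∀ y w, 0 < w → 1 ≤ w * L y →
        LowerBarrier μ v a b (j + 1) (A + w • rankOne ℂ (v y) (v y)) := by
  obtain ⟨L, hLi, hLc, hL⟩ := exists_lower_barrier_step hv hv1 hv0 h.1 ha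
    ((mul_le_mul_of_nonneg_left h.2 ha.le).trans_lt hab)
  refine ⟨L, hLi, (sub_le_sub_left h.2 _).trans hLc, fun y w hw hwL => ?_⟩
  have e : A + w • rankOne ℂ (v y) (v y) + (b - (j + 1 : ℕ) * a) • (1 : F →L[ℂ] F) =
      A + (b - j * a) • (1 : F →L[ℂ] F) - a • (1 : F →L[ℂ] F) +
        w • rankOne ℂ (v y) (v y) := by
    push_cast
    module
  obtain ⟨h1, h2⟩ := hL y w hw hwL
  rw [LowerBarrier, e]
  exact ⟨h1, h2.trans h.2⟩

theorem LowerBarrier.le_re_inner {v : D → F} (hv : MemLp v 2 μ) (hv1 : frameOp μ v = 1)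
    {a b d : ℝ} (hb : 0 < b) (hd : ∫ x, ‖v x‖ ^ 2 ∂μ = d) (hd0 : 0 < d) {n : ℕ}
    {A : F →L[ℂ] F} (h : LowerBarrier μ v a b n A) (e : F) :
    (n * a - b + b / d) * ‖e‖ ^ 2 ≤ (inner ℂ e (A e)).re := by
  obtain ⟨h1, h2⟩ := h
  rw [hd] at h2
  set Y := A + (b - n * a) • (1 : F →L[ℂ] F) with hY
  have h3 := re_inner_le_of_le (frameOp_le_smul hv h1) e
  have h0 : (inner ℂ e e).re = ‖e‖ ^ 2 := inner_self_eq_norm_sq (𝕜 := ℂ) e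
  rw [smul_apply, re_inner_real_smul_right, hv1, one_apply_eq_self, h0] at h3
  have h4 := h3.trans (mul_le_mul_of_nonneg_right h2 (re_inner_nonneg h1.nonneg e))
  have h5 : (inner ℂ e (Y e)).re = (inner ℂ e (A e)).re + (b - n * a) * ‖e‖ ^ 2 := by
    rw [hY, add_apply, smul_apply, inner_add_right, Complex.add_re, re_inner_real_smul_right,
      one_apply_eq_self, h0]
  have h6 : b / d * ‖e‖ ^ 2 ≤ (inner ℂ e (Y e)).re := by
    calc b / d * ‖e‖ ^ 2 ≤ b / d * (d / b * (inner ℂ e (Y e)).re) := by gcongr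
      _ = _ := by field_simp
  linarith

end Greedy

/-! ### Choice of constants and simultaneous frame bounds -/

section Points

variable {D : Type*} [MeasurableSpace D] {μ : Measure D}

theorem integral_norm_sq_of_frameOp_eq_one {d : ℕ} {v : D → EuclideanSpace ℂ (Fin d)}
    (hv : MemLp v 2 μ) (hv1 : frameOp μ v = 1) : ∫ x, ‖v x‖ ^ 2 ∂μ = d := by
  have h : ∀ i : Fin d, ∫ x, ‖v x i‖ ^ 2 ∂μ = 1 := fun i => by
    have h := re_inner_frameOp hv (EuclideanSpace.single i 1)
    rw [hv1, one_apply_eq_self] at h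
    simpa [EuclideanSpace.inner_single_right] using h.symm
  have hi : ∀ i : Fin d, Integrable (fun x => ‖v x i‖ ^ 2) μ := fun i =>
    ((EuclideanSpace.proj (𝕜 := ℂ) i).comp_memLp' hv).norm.integrable_sq
  simp_rw [EuclideanSpace.norm_sq_eq]
  rw [integral_finsetSum _ fun i _ => hi i]
  simp [h]

theorem norm_inner_fin_one (a e : EuclideanSpace ℂ (Fin 1)) :
    ‖inner ℂ a e‖ = ‖a‖ * ‖e‖ := by
  simp [EuclideanSpace.norm_eq, PiLp.inner_apply, mul_comm]

variable [IsProbabilityMeasure μ]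

/-- Points and weights for which the discrete lower frame bound on a `d`-dimensional space and the
discrete upper frame bound on a Hilbert space hold simultaneously. -/
theorem exists_points_frame_bounds
    {E : Type*} [NormedAddCommGroup E] [InnerProductSpace ℂ E] [CompleteSpace E]
    {k : D → E} (hk : MemLp k 2 μ) (hk0 : ∀ x, k x ≠ 0)
    (hpos : ∀ e : E, e ≠ 0 → 0 < ∫ x, ‖inner ℂ (k x) e‖ ^ 2 ∂μ)
    (hle : ∀ e : E, ∫ x, ‖inner ℂ (k x) e‖ ^ 2 ∂μ ≤ ‖e‖ ^ 2)
    {M : ℝ} (hM : ∫ x, ‖k x‖ ^ 2 ∂μ = M + 1) (hM1 : 1 ≤ M)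
    {d n : ℕ} (hd : 1 ≤ d) (hdn : d ≤ n) {v : D → EuclideanSpace ℂ (Fin d)}
    (hv : MemLp v 2 μ) (hv1 : frameOp μ v = 1) {s : Set D} (hs : μ sᶜ = 0) :
    ∃ (x : Fin n → D) (w : Fin n → ℝ), (∀ i, x i ∈ s) ∧ (∀ i, 0 < w i) ∧
      (∀ e, ∑ i, w i * ‖inner ℂ (k (x i)) e‖ ^ 2 ≤ (1 + √(M / n)) ^ 2 * ‖e‖ ^ 2) ∧
      ∀ c, (1 - √(((d : ℝ) - 1) / n)) ^ 2 * ‖c‖ ^ 2 ≤ ∑ i, w i * ‖inner ℂ (v (x i)) c‖ ^ 2 := by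
  have hn0 : (0 : ℝ) < n := by exact_mod_cast hd.trans hdn
  have hn1 : (1 : ℝ) ≤ n := by exact_mod_cast hd.trans hdn
  have hd1 : (1 : ℝ) ≤ d := by exact_mod_cast hd
  have hdn' : (d : ℝ) ≤ n := by exact_mod_cast hdn
  have hvd := integral_norm_sq_of_frameOp_eq_one hv hv1
  set r := √(M / n) with hr
  have hr0 : 0 < r := Real.sqrt_pos.2 (by positivity)
  have hr2 : n * r ^ 2 = M := by
    rw [hr, Real.sq_sqrt (by positivity)]; field_simp
  have hnr : 1 ≤ n * r := by
    by_contra! h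
    have h1 : (n * r) ^ 2 < 1 := by
      rw [sq_lt_one_iff₀ (by positivity)]; exact h
    nlinarith
  -- With these values `1 / a = n / (1 + r)` and `(M + 1) / b = n r / (1 + r)` add up to `n`, and
  -- the final bound is `(1 + r)²`.
  set a := (1 + r) / n with ha
  set b := (1 + r) * (M + 1) / (n * r) with hb
  have ha0 : 0 < a := by positivity
  have hb0 : 0 < b := by positivity
  have hc : 1 / a + (M + 1) / b = n := by
    rw [ha, hb]; field_simp
  have hbM : b / (M + 1) = (1 + r) / (n * r) := by rw [hb]; field_simp
  have hna : n * a = 1 + r := by rw [ha]; field_simp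
  have hab : b / (M + 1) ≤ n * a := by
    rw [hbM, hna]; exact div_le_self (by positivity) hnr
  have hfin : b + n * a - b / (M + 1) = (1 + r) ^ 2 := by
    rw [hna, hbM, hb, ← hr2]; field_simp; ring
  have hpos' : ∀ e : E, e ≠ 0 → 0 < (inner ℂ e (frameOp μ k e)).re := fun e he => by
    rw [re_inner_frameOp hk]; exact hpos e he
  have hle' : ∀ e : E, (inner ℂ e (frameOp μ k e)).re ≤ ‖e‖ ^ 2 := fun e => by
    rw [re_inner_frameOp hk]; exact hle e
  have hUstep : ∀ j B, UpperBarrier μ k a b j B → ∃ U : D → ℝ, Integrable U μ ∧ (∀ y, 0 < U y) ∧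
      ∫ y, U y ∂μ ≤ n ∧ ∀ y w, 0 < w → w * U y ≤ 1 →
        UpperBarrier μ k a b (j + 1) (B + w • rankOne ℂ (k y) (k y)) := fun j B h => by
    rw [← hc, ← hM]
    exact h.exists_step hk hk0 hpos' ha0
  have hUend : ∀ B, UpperBarrier μ k a b n B → ∀ e,
      (inner ℂ e (B e)).re ≤ (1 + r) ^ 2 * ‖e‖ ^ 2 := fun B h e => by
    rw [← hfin]
    exact h.re_inner_le hk hle' hb0 hM (by positivity) hab e
  suffices h : ∃ PL : ℕ → (EuclideanSpace ℂ (Fin d) →L[ℂ] EuclideanSpace ℂ (Fin d)) → Prop,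
      PL 0 0 ∧ (∀ j A, PL j A → ∃ L : D → ℝ, Integrable L μ ∧ n ≤ ∫ y, L y ∂μ ∧
        ∀ y w, 0 < w → 1 ≤ w * L y → PL (j + 1) (A + w • rankOne ℂ (v y) (v y))) ∧
      ∀ A, PL n A → ∀ c,
        (1 - √(((d : ℝ) - 1) / n)) ^ 2 * ‖c‖ ^ 2 ≤ (inner ℂ c (A c)).re by
    obtain ⟨PL, hL0, hLstep, hLend⟩ := h
    obtain ⟨x, w, hx, hw, hxU, hxL⟩ := exists_points_of_barriers hs n (UpperBarrier μ k a b) PL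
      (UpperBarrier.zero k a hb0) hL0 hUstep hLstep n
    refine ⟨x, w, hx, hw, fun e => ?_, fun c => ?_⟩
    · rw [← re_inner_sum_rankOne]
      exact hUend _ hxU e
    · rw [← re_inner_sum_rankOne]
      exact hLend _ hxL c
  rcases hd.eq_or_lt with rfl | hd2
  -- For `d = 1` the constant `β` used below would be infinite. In one dimension no potential is
  -- needed: each step adds at least `1 / n`.
  · refine ⟨fun j A => ∀ c, (j / n : ℝ) * ‖c‖ ^ 2 ≤ (inner ℂ c (A c)).re, by simp, ?_, ?_⟩
    · intro j A h
      refine ⟨fun y => n * ‖v y‖ ^ 2, hv.norm.integrable_sq.const_mul _, ?_, fun y w hw hwy c => ?_⟩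
      · rw [integral_const_mul, hvd]; simp
      · rw [add_apply, smul_apply, inner_add_right, Complex.add_re, re_inner_real_smul_right,
          re_inner_rankOne_self, norm_inner_fin_one, mul_pow, ← mul_assoc]
        have h1 : 1 / (n : ℝ) ≤ w * ‖v y‖ ^ 2 := by
          rw [div_le_iff₀ hn0]; linarith
        have h2 := mul_le_mul_of_nonneg_right h1 (sq_nonneg ‖c‖)
        have h3 : ((j + 1 : ℕ) : ℝ) / n * ‖c‖ ^ 2 = j / n * ‖c‖ ^ 2 + 1 / n * ‖c‖ ^ 2 := by
          push_cast; ring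
        rw [h3]
        exact add_le_add (h c) h2
    · intro A h c
      have := h c
      rw [div_self hn0.ne'] at this
      simpa using this
  · have hd2' : (1 : ℝ) < d := by exact_mod_cast hd2
    set t := √(((d : ℝ) - 1) / n) with ht
    have ht0 : 0 < t := Real.sqrt_pos.2 (div_pos (by linarith) hn0)
    have ht1 : t < 1 := by
      rw [ht, Real.sqrt_lt' one_pos, one_pow, div_lt_one hn0]; linarith
    have ht2 : n * t ^ 2 + 1 = d := by
      rw [ht, Real.sq_sqrt (div_pos (by linarith) hn0).le]; field_simp; ring
    have ht1' : 0 < 1 - t := by linarith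
    -- Here `1 / α = n / (1 - t)` and `d / β = n t / (1 - t)` differ by `n`, matching the upper
    -- mean.
    set α := (1 - t) / n with hα
    set β := (1 - t) * d / (n * t) with hβ
    have hα0 : 0 < α := by positivity
    have hβ0 : 0 < β := by positivity
    have hdβ : d / β = n * t / (1 - t) := by rw [hβ]; field_simp
    have hcc : 1 / α - d / β = n := by
      rw [hdβ, hα]; field_simp
    have hαβ : α * (d / β) < 1 := by
      rw [hdβ, hα]
      calc (1 - t) / n * (n * t / (1 - t)) = t := by field_simp
        _ < 1 := ht1
    have hend : n * α - β + β / d = (1 - t) ^ 2 := by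
      have h1 : β / d = (1 - t) / (n * t) := by rw [hβ]; field_simp
      rw [h1, hβ, hα, ← ht2]; field_simp; ring
    refine ⟨LowerBarrier μ v α β, LowerBarrier.zero v α hβ0, fun j A h => ?_, fun A h c => ?_⟩
    · rw [← hcc, ← hvd]
      exact h.exists_step hv hv1 (by rw [hvd]; linarith) hα0 (by rwa [hvd])
    · rw [← hend]
      exact h.le_re_inner hv hv1 hβ0 hvd (by linarith) c

end Points

/-! ### Orthonormal systems for genuine functions -/

section SquareIntegrable

variable {D : Type*} [MeasurableSpace D] {μ : Measure D}

theorem l2Norm_sq {f : D → ℂ} (hf : MemLp f 2 μ) : l2Norm μ f ^ 2 = ∫ x, ‖f x‖ ^ 2 ∂μ := by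
  have h0 : 0 ≤ ∫ x, ‖f x‖ ^ 2 ∂μ := integral_nonneg fun x => by positivity
  rw [l2Norm, hf.eLpNorm_eq_integral_rpow_norm two_ne_zero ENNReal.ofNat_ne_top]
  simp only [ENNReal.toReal_ofNat, Real.rpow_two]
  rw [ENNReal.toReal_ofReal (by positivity), ← Real.rpow_natCast, ← Real.rpow_mul h0]
  norm_num

theorem l2Norm_nonneg (f : D → ℂ) : 0 ≤ l2Norm μ f := ENNReal.toReal_nonneg

theorem frameOp_eq_one {E : Type*} [NormedAddCommGroup E] [InnerProductSpace ℂ E]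
    [CompleteSpace E] {v : D → E} (hv : MemLp v 2 μ)
    (h : ∀ c, ∫ x, ‖inner ℂ (v x) c‖ ^ 2 ∂μ = ‖c‖ ^ 2) : frameOp μ v = 1 := by
  have hs : IsSelfAdjoint (frameOp μ v) := .of_nonneg (frameOp_nonneg hv)
  have h1 : ∀ c, (inner ℂ c (frameOp μ v c)).re = (inner ℂ c ((1 : E →L[ℂ] E) c)).re := fun c => by
    rw [re_inner_frameOp hv, h]
    exact (inner_self_eq_norm_sq (𝕜 := ℂ) c).symm
  exact le_antisymm (le_of_re_inner_le hs (.one _) fun c => (h1 c).le)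
    (le_of_re_inner_le (.one _) hs fun c => (h1 c).ge)

/-- The functions in a finite-dimensional space that vanish almost everywhere vanish
simultaneously outside of one null set. -/
theorem exists_null_compl_forall_eq_zero (V : Submodule ℂ (D → ℂ)) [FiniteDimensional ℂ V] :
    ∃ s : Set D, μ sᶜ = 0 ∧ ∀ g ∈ V, g =ᵐ[μ] 0 → ∀ x ∈ s, g x = 0 := by
  let N : Submodule ℂ (D → ℂ) :=
    { carrier := {g | g ∈ V ∧ g =ᵐ[μ] 0}
      zero_mem' := ⟨V.zero_mem, .rfl⟩
      add_mem' := fun {f g} hf hg => ⟨V.add_mem hf.1 hg.1, by simpa using hf.2.add hg.2⟩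
      smul_mem' := fun c f hf => ⟨V.smul_mem c hf.1, by simpa using hf.2.const_smul c⟩ }
  have hNV : N ≤ V := fun g hg => hg.1
  have : FiniteDimensional ℂ N := Submodule.finiteDimensional_of_le hNV
  let β := Module.finBasis ℂ N
  refine ⟨{x | ∀ i, (β i : D → ℂ) x = 0}, ?_, fun g hgV hg x hx => ?_⟩
  · have h : ∀ᵐ x ∂μ, ∀ i, (β i : D → ℂ) x = 0 := ae_all_iff.2 fun i => (β i).2.2
    exact h
  · have h1 : g = ∑ i, β.repr ⟨g, hgV, hg⟩ i • (β i : D → ℂ) := by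
      have h2 := congrArg N.subtype (β.sum_repr ⟨g, hgV, hg⟩)
      rw [map_sum] at h2
      exact h2.symm
    rw [h1, Finset.sum_apply]
    exact Finset.sum_eq_zero fun i _ => by simp [hx i]

/-- An `L₂`-orthonormal system representing a finite-dimensional space of square-integrable
functions pointwise outside of a null set. -/
theorem exists_frame_of_submodule [IsProbabilityMeasure μ] (V : Submodule ℂ (D → ℂ))
    [FiniteDimensional ℂ V] (hV : ∀ f ∈ V, MemLp f 2 μ) :
    ∃ d, 1 ≤ d ∧ d ≤ max 1 (Module.finrank ℂ V) ∧ ∃ v : D → EuclideanSpace ℂ (Fin d),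
      MemLp v 2 μ ∧ frameOp μ v = 1 ∧ ∃ s : Set D, μ sᶜ = 0 ∧
        ∀ f ∈ V, ∃ c, ‖c‖ = l2Norm μ f ∧ ∀ x ∈ s, inner ℂ (v x) c = f x := by
  obtain ⟨s, hs, hs0⟩ := exists_null_compl_forall_eq_zero (μ := μ) V
  let T : V →ₗ[ℂ] Lp ℂ 2 μ :=
    { toFun := fun f => (hV f f.2).toLp f
      map_add' := fun f g => rfl
      map_smul' := fun c f => rfl }
  have hT0 : ∀ f : V, T f = 0 → (f : D → ℂ) =ᵐ[μ] 0 := fun f h =>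
    ((hV f f.2).coeFn_toLp).symm.trans ((Lp.eq_zero_iff_ae_eq_zero).1 h)
  have hTn : ∀ f : V, ‖T f‖ = l2Norm μ f := fun f => Lp.norm_toLp _ (hV f f.2)
  have hrank : Module.finrank ℂ (LinearMap.range T) ≤ Module.finrank ℂ V :=
    LinearMap.finrank_range_le T
  rcases Nat.eq_zero_or_pos (Module.finrank ℂ (LinearMap.range T)) with h0 | h1
  · have hT : ∀ f, T f = 0 := fun f => by
      have h := Submodule.finrank_eq_zero.1 h0
      exact (Submodule.mem_bot ℂ).1 (h ▸ LinearMap.mem_range_self T f)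
    -- If all of `V` vanishes in `L₂`, a constant unit vector in `ℂ^1` serves as a dummy frame, and
    -- every `f` is represented by `0`.
    refine ⟨1, le_rfl, le_max_left _ _, fun _ => EuclideanSpace.single 0 1, memLp_const _,
      frameOp_eq_one (memLp_const _) fun c => ?_, s, hs, fun f hf => ⟨0, ?_, fun x hx => ?_⟩⟩
    · simp [norm_inner_fin_one]
    · rw [norm_zero, ← hTn ⟨f, hf⟩, hT, norm_zero]
    · rw [inner_zero_right, hs0 f hf (hT0 ⟨f, hf⟩ (hT _)) x hx]
  · let b := stdOrthonormalBasis ℂ (LinearMap.range T)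
    choose φ hφ using fun i => (b i).2
    let v : D → EuclideanSpace ℂ (Fin (Module.finrank ℂ (LinearMap.range T))) := fun x =>
      WithLp.toLp 2 fun i => starRingEnd ℂ ((φ i : D → ℂ) x)
    have hvc : ∀ x c, inner ℂ (v x) c = ((∑ i, c i • φ i : V) : D → ℂ) x := fun x c => by
      simp [v, PiLp.inner_apply]
    have hTc : ∀ c : EuclideanSpace ℂ (Fin (Module.finrank ℂ (LinearMap.range T))),
        T (∑ i, c i • φ i) = (b.repr.symm c : LinearMap.range T) := fun c => by
      rw [← b.sum_repr_symm, map_sum]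
      simp [hφ]
    have hv : MemLp v 2 μ := by
      refine MemLp.of_eval_piLp fun i => ?_
      exact (hV _ (φ i).2).star
    refine ⟨_, h1, hrank.trans (le_max_right _ _), v, hv, frameOp_eq_one hv fun c => ?_, s, hs,
      fun f hf => ⟨b.repr ⟨T ⟨f, hf⟩, LinearMap.mem_range_self T _⟩, ?_, fun x hx => ?_⟩⟩
    · simp_rw [hvc]
      rw [← l2Norm_sq (hV _ (Subtype.property _)), ← hTn, hTc]
      exact congrArg (· ^ 2) (b.repr.symm.norm_map c)
    · rw [LinearIsometryEquiv.norm_map, ← hTn ⟨f, hf⟩]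
      rfl
    · rw [hvc]
      set c := b.repr ⟨T ⟨f, hf⟩, LinearMap.mem_range_self T _⟩ with hc
      -- The lift of the basis expansion agrees with `f` only almost everywhere; the difference lies
      -- in `V`, so it vanishes on all of `s`.
      have h2 : T (∑ i, c i • φ i - ⟨f, hf⟩) = 0 := by
        rw [map_sub, hTc, hc, LinearIsometryEquiv.symm_apply_apply, sub_self]
      have h3 := hs0 _ (Subtype.property _) (hT0 _ h2) x hx
      rw [Submodule.coe_sub, Pi.sub_apply, sub_eq_zero] at h3
      exact h3

theorem integral_norm_add_const_sq [IsProbabilityMeasure μ] {f : D → ℂ} (hf : MemLp f 2 μ)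
    (hf0 : ∫ x, f x ∂μ = 0) (c : ℂ) :
    ∫ x, ‖f x + c‖ ^ 2 ∂μ = ∫ x, ‖f x‖ ^ 2 ∂μ + ‖c‖ ^ 2 := by
  have hi : Integrable f μ := hf.integrable one_le_two
  have h1 : ∀ x, ‖f x + c‖ ^ 2 = ‖f x‖ ^ 2 + (2 * (starRingEnd ℂ c * f x).re + ‖c‖ ^ 2) :=
    fun x => by
      rw [← Complex.normSq_eq_norm_sq, Complex.normSq_add, Complex.normSq_eq_norm_sq,
        Complex.normSq_eq_norm_sq, mul_comm (f x)]
      ring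
  have hci : Integrable (fun x => starRingEnd ℂ c * f x) μ := hi.const_mul _
  have h2 : ∫ x, (starRingEnd ℂ c * f x).re ∂μ = 0 := by
    have := integral_re hci
    simp only [RCLike.re_to_complex] at this
    rw [this, integral_const_mul, hf0, mul_zero, Complex.zero_re]
  have hre : Integrable (fun x => 2 * (starRingEnd ℂ c * f x).re) μ := hci.re.const_mul 2
  simp_rw [h1]
  rw [integral_add hf.norm.integrable_sq (hre.fun_add (integrable_const _)),
    integral_add hre (integrable_const _), integral_const_mul, h2]
  simp

end SquareIntegrable

/-! ### The reproducing kernel extended by constants -/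

section Kernel

variable {D : Type*} {H : Type*} [NormedAddCommGroup H] [InnerProductSpace ℂ H] [RKHS ℂ H D ℂ]

section

variable [MeasurableSpace D] {μ : Measure D}

theorem l2Norm_sq_le_embeddingConst (hbdd : BddAbove (embeddingQuotients μ H)) (g : H) :
    l2Norm μ g ^ 2 ≤ embeddingConst μ H * ‖g‖ ^ 2 := by
  by_cases hg : g = 0
  · subst hg
    have : (⇑(0 : H) : D → ℂ) = 0 := RKHS.coe_zero
    rw [this]
    simp [l2Norm]
  · rw [← div_le_iff₀ (by positivity)]
    exact le_csSup hbdd ⟨g, hg, rfl⟩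

theorem embeddingConst_pos [Nontrivial H] (hbdd : BddAbove (embeddingQuotients μ H))
    (hinj : ∀ g : H, g ≠ 0 → l2Norm μ g ≠ 0) : 0 < embeddingConst μ H := by
  obtain ⟨g, hg⟩ := exists_ne (0 : H)
  have h := l2Norm_sq_le_embeddingConst hbdd g
  have h1 : 0 < l2Norm μ g ^ 2 := by
    have := hinj g hg
    positivity
  exact pos_of_mul_pos_left (h1.trans_le h) (by positivity)

end

variable [CompleteSpace H]

theorem inner_kerFun_one (x : D) (g : H) : inner ℂ (RKHS.kerFun H x (1 : ℂ)) g = g x := by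
  simp

theorem kernelDiag_eq_norm_sq (x : D) : kernelDiag H x = ‖RKHS.kerFun H x (1 : ℂ)‖ ^ 2 := by
  rw [kernelDiag, ← inner_self_eq_norm_sq (𝕜 := ℂ), ← RKHS.kernel_inner]
  simp

theorem kernelDiag_nonneg (x : D) : 0 ≤ kernelDiag H x := by
  rw [kernelDiag_eq_norm_sq]; positivity

theorem norm_apply_sq_le (g : H) (x : D) : ‖g x‖ ^ 2 ≤ kernelDiag H x * ‖g‖ ^ 2 := by
  rw [kernelDiag_eq_norm_sq, ← mul_pow, ← inner_kerFun_one]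
  gcongr
  exact norm_inner_le_norm _ _

/-- The rescaled kernel functions, extended by a coordinate that represents the constants. -/
def extendedKernel (H : Type*) [NormedAddCommGroup H] [InnerProductSpace ℂ H] [CompleteSpace H]
    [RKHS ℂ H D ℂ] (t : ℝ) (x : D) : WithLp 2 (H × ℂ) :=
  WithLp.toLp 2 ((t : ℂ) • RKHS.kerFun H x (1 : ℂ), 1)

theorem inner_extendedKernel (t : ℝ) (x : D) (e : WithLp 2 (H × ℂ)) :
    inner ℂ (extendedKernel H t x) e = t * e.fst x + e.snd := by
  have h : inner ℂ ((t : ℂ) • RKHS.kerFun H x (1 : ℂ)) e.fst = t * e.fst x := by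
    rw [inner_smul_left, inner_kerFun_one, Complex.conj_ofReal]
  rw [WithLp.prod_inner_apply, ← h]
  congr 1
  simp [extendedKernel]

theorem norm_sq_extendedKernel (t : ℝ) (x : D) :
    ‖extendedKernel H t x‖ ^ 2 = t ^ 2 * kernelDiag H x + 1 := by
  rw [WithLp.prod_norm_sq_eq_of_L2, kernelDiag_eq_norm_sq]
  simp [extendedKernel, norm_smul, mul_pow]

variable [MeasurableSpace D] {μ : Measure D}

theorem l2Norm_sq_le_kernelTrace (hHL2 : ∀ g : H, MemLp (g : D → ℂ) 2 μ)
    (htrace : Integrable (kernelDiag (D := D) H) μ) (g : H) :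
    l2Norm μ g ^ 2 ≤ kernelTrace μ H * ‖g‖ ^ 2 := by
  rw [l2Norm_sq (hHL2 g), kernelTrace, ← integral_mul_const]
  exact integral_mono (hHL2 g).norm.integrable_sq (htrace.mul_const _) fun x => norm_apply_sq_le g x

theorem embeddingConst_le_kernelTrace [Nontrivial H] (hHL2 : ∀ g : H, MemLp (g : D → ℂ) 2 μ)
    (htrace : Integrable (kernelDiag (D := D) H) μ) : embeddingConst μ H ≤ kernelTrace μ H := by
  obtain ⟨g, hg⟩ := exists_ne (0 : H)
  refine csSup_le ⟨_, g, hg, rfl⟩ ?_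
  rintro _ ⟨f, hf, rfl⟩
  rw [div_le_iff₀ (by positivity)]
  exact l2Norm_sq_le_kernelTrace hHL2 htrace f

/-- If the kernel has finite trace and the Hilbert space embeds injectively into `L₂`, then its
orthonormal systems are countable. -/
theorem countable_of_orthonormal (hHL2 : ∀ g : H, MemLp (g : D → ℂ) 2 μ)
    (hinj : ∀ g : H, g ≠ 0 → l2Norm μ g ≠ 0)
    (htrace : Integrable (kernelDiag (D := D) H) μ) {ι : Type*} {e : ι → H}
    (he : Orthonormal ℂ e) : Countable ι := by
  have hsum : Summable fun i => l2Norm μ (e i) ^ 2 := by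
    refine summable_of_sum_le (c := kernelTrace μ H) (fun i => by positivity) fun u => ?_
    simp_rw [l2Norm_sq (hHL2 _)]
    rw [← integral_finsetSum _ fun i _ => (hHL2 (e i)).norm.integrable_sq]
    refine integral_mono (integrable_finsetSum _ fun i _ => (hHL2 (e i)).norm.integrable_sq) htrace
      fun x => ?_
    have h := he.sum_inner_products_le (RKHS.kerFun H x (1 : ℂ)) (s := u)
    rw [← kernelDiag_eq_norm_sq] at h
    -- Bessel's inequality for `K_x` bounds `∑ |e_i(x)|²` by `K(x,x)`. The sum of all `‖e_i‖₂²` is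
    -- therefore finite, with no zero term.
    refine le_trans (le_of_eq (Finset.sum_congr rfl fun i _ => ?_)) h
    rw [norm_inner_symm, inner_kerFun_one]
  have h := hsum.countable_support
  have huniv : (Function.support fun i => l2Norm μ (e i) ^ 2) = Set.univ :=
    Set.eq_univ_of_forall fun i => pow_ne_zero 2 (hinj _ (he.ne_zero i))
  rw [huniv] at h
  exact Set.countable_univ_iff.1 h

/-- Only strong measurability is at issue. A Hilbert basis is countable, so `x ↦ K_x` is a pointwise
limit of its partial expansions, whose coefficients are conjugates of functions in `H`. -/
theorem memLp_kerFun (hHL2 : ∀ g : H, MemLp (g : D → ℂ) 2 μ)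
    (hinj : ∀ g : H, g ≠ 0 → l2Norm μ g ≠ 0)
    (htrace : Integrable (kernelDiag (D := D) H) μ) :
    MemLp (fun x => RKHS.kerFun H x (1 : ℂ)) 2 μ := by
  obtain ⟨w, b, -⟩ := exists_hilbertBasis ℂ H
  have : Countable w := countable_of_orthonormal hHL2 hinj htrace b.orthonormal
  have hm : AEStronglyMeasurable (fun x => RKHS.kerFun H x (1 : ℂ)) μ := by
    refine aestronglyMeasurable_of_tendsto_ae (Filter.atTop : Filter (Finset w))
      (f := fun u x => ∑ i ∈ u, b.repr (RKHS.kerFun H x (1 : ℂ)) i • b i) (fun u => ?_)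
      (.of_forall fun x => b.hasSum_repr _)
    refine Finset.aestronglyMeasurable_fun_sum u fun i _ => ?_
    have h : ∀ x, b.repr (RKHS.kerFun H x (1 : ℂ)) i = star (b i x) := fun x => by
      rw [b.repr_apply_apply, ← inner_conj_symm, inner_kerFun_one]; rfl
    simp_rw [h]
    exact (hHL2 (b i)).aestronglyMeasurable.star.smul_const _
  rw [memLp_two_iff_integrable_sq_norm hm]
  simp_rw [← kernelDiag_eq_norm_sq]
  exact htrace

theorem memLp_extendedKernel [IsFiniteMeasure μ]
    (hk : MemLp (fun x => RKHS.kerFun H x (1 : ℂ)) 2 μ) (t : ℝ) :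
    MemLp (extendedKernel H t) 2 μ := by
  have hm : AEStronglyMeasurable (extendedKernel H t : D → WithLp 2 (H × ℂ)) μ :=
    (WithLp.prod_continuous_toLp 2 H ℂ).comp_aestronglyMeasurable
      ((hk.aestronglyMeasurable.const_smul (t : ℂ)).prodMk aestronglyMeasurable_const)
  rw [memLp_two_iff_integrable_sq_norm hm]
  simp_rw [norm_sq_extendedKernel, kernelDiag_eq_norm_sq]
  exact (hk.norm.integrable_sq.const_mul _).add (integrable_const _)

theorem integral_norm_inner_extendedKernel_sq [IsProbabilityMeasure μ]
    (hHL2 : ∀ g : H, MemLp (g : D → ℂ) 2 μ) (hmean : ∀ g : H, ∫ x, g x ∂μ = 0) (t : ℝ)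
    (e : WithLp 2 (H × ℂ)) :
    ∫ x, ‖inner ℂ (extendedKernel H t x) e‖ ^ 2 ∂μ =
      t ^ 2 * l2Norm μ e.fst ^ 2 + ‖e.snd‖ ^ 2 := by
  simp_rw [inner_extendedKernel]
  rw [integral_norm_add_const_sq ((hHL2 e.fst).const_mul _)
    (by rw [integral_const_mul, hmean, mul_zero]), l2Norm_sq (hHL2 _), ← integral_const_mul]
  simp [mul_pow]

end Kernel

end NormDiscretization

/-! ### Assembly of the theorem -/

theorem proposition2p2
    {D : Type*} [MeasurableSpace D] (μ : Measure D) [IsProbabilityMeasure μ]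
    -- an `m`-dimensional space of square-integrable functions
    (m : ℕ) (hm : 1 ≤ m) (V : Submodule ℂ (D → ℂ)) (hVdim : Module.finrank ℂ V = m)
    (hVL2 : ∀ f ∈ V, MemLp f 2 μ)
    -- a complex reproducing kernel Hilbert space of functions on `D`
    {H : Type*} [NormedAddCommGroup H] [InnerProductSpace ℂ H] [CompleteSpace H]
    [RKHS ℂ H D ℂ] [Nontrivial H]
    -- `H` is embedded in `L₂`, continuously and injectively
    (hHL2 : ∀ g : H, MemLp (g : D → ℂ) 2 μ)
    (hHcont : BddAbove (NormDiscretization.embeddingQuotients μ H))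
    (hHinj : ∀ g : H, g ≠ 0 → NormDiscretization.l2Norm μ g ≠ 0)
    -- the kernel has finite trace
    (hHtrace : Integrable (NormDiscretization.kernelDiag (D := D) H) μ)
    -- all functions in `H` have mean zero
    (hHmean : ∀ g : H, ∫ x, g x ∂μ = 0)
    (n : ℕ) (hmn : m ≤ n) :
    ∃ (x : Fin n → D) (w : Fin n → ℝ),
      (∀ i, 0 < w i) ∧
      (∀ f ∈ V,
        (1 - √(((m : ℝ) - 1) / (n : ℝ))) * NormDiscretization.l2Norm μ f
          ≤ √(∑ i, w i * ‖f (x i)‖ ^ 2)) ∧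
      (∀ g : H,
        √(∑ i, w i * ‖g (x i)‖ ^ 2)
          ≤ (1 + √(NormDiscretization.effectiveDim μ H / (n : ℝ)))
              * √(NormDiscretization.embeddingConst μ H) * ‖g‖) ∧
      ∑ i, w i ≤ (1 + √(NormDiscretization.effectiveDim μ H / (n : ℝ))) ^ 2 := by
  open NormDiscretization in
  have : FiniteDimensional ℂ V := FiniteDimensional.of_finrank_pos (by omega)
  obtain ⟨d, hd1, hdm, v, hv, hv1, s, hs, hVs⟩ := exists_frame_of_submodule V hVL2
  rw [hVdim, max_eq_right hm] at hdm
  have hlam := embeddingConst_pos hHcont hHinj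
  set lam := embeddingConst μ H with hlam_def
  have ht2 : (√lam)⁻¹ ^ 2 = lam⁻¹ := by rw [inv_pow, Real.sq_sqrt hlam.le]
  have hM1 : 1 ≤ effectiveDim μ H := by
    rw [effectiveDim, one_le_div hlam]
    exact embeddingConst_le_kernelTrace hHL2 hHtrace
  have hint := integral_norm_inner_extendedKernel_sq hHL2 hHmean (√lam)⁻¹
  obtain ⟨x, w, hx, hw, hup, hlow⟩ := exists_points_frame_bounds (n := n)
    (memLp_extendedKernel (memLp_kerFun hHL2 hHinj hHtrace) (√lam)⁻¹) (fun x h => by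
      have h1 := norm_sq_extendedKernel (H := H) (√lam)⁻¹ x
      have h2 : 0 ≤ (√lam)⁻¹ ^ 2 * kernelDiag H x :=
        mul_nonneg (sq_nonneg _) (kernelDiag_nonneg x)
      rw [h, norm_zero] at h1
      linarith)
    (fun e he => by
      rw [hint]
      by_cases h1 : e.fst = 0
      · have h2 : e.snd ≠ 0 := fun h2 => he ((WithLp.equiv 2 (H × ℂ)).injective (Prod.ext h1 h2))
        positivity
      · have h2 := hHinj _ h1
        positivity)
    (fun e => by
      rw [hint, WithLp.prod_norm_sq_eq_of_L2, ht2]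
      gcongr
      rw [inv_mul_le_iff₀ hlam]
      exact l2Norm_sq_le_embeddingConst hHcont e.fst)
    (M := effectiveDim μ H) (by
      simp_rw [norm_sq_extendedKernel, ht2]
      rw [integral_add (hHtrace.const_mul _) (integrable_const _), integral_const_mul,
        effectiveDim, kernelTrace, div_eq_inv_mul]
      simp [lam])
    hM1 hd1 (hdm.trans hmn) hv hv1 hs
  have hn0 : (0 : ℝ) < n := by exact_mod_cast hm.trans hmn
  refine ⟨x, w, hw, fun f hf => ?_, fun g => ?_, ?_⟩
  · obtain ⟨c, hc, hcf⟩ := hVs f hf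
    have h := hlow c
    simp_rw [hcf _ (hx _), hc] at h
    -- Passing from `d` to `m` only weakens the bound, as `d ≤ m`.
    have hle : (1 - √(((m : ℝ) - 1) / n)) ≤ 1 - √(((d : ℝ) - 1) / n) := by gcongr
    have h0 : 0 ≤ 1 - √(((d : ℝ) - 1) / n) := by
      have h1 : (d : ℝ) ≤ n := by exact_mod_cast hdm.trans hmn
      rw [sub_nonneg, Real.sqrt_le_one, div_le_one hn0]
      linarith
    refine (mul_le_mul_of_nonneg_right hle (l2Norm_nonneg f)).trans (Real.le_sqrt_of_sq_le ?_)
    rwa [mul_pow]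
  · have h := hup (WithLp.toLp 2 (g, 0))
    simp_rw [inner_extendedKernel, WithLp.prod_norm_sq_eq_of_L2] at h
    simp only [norm_mul, add_zero, mul_pow, norm_zero, ne_eq, OfNat.ofNat_ne_zero,
      not_false_eq_true, zero_pow, Complex.norm_real, norm_inv, Real.norm_eq_abs,
      WithLp.toLp_fst, WithLp.toLp_snd] at h
    refine Real.sqrt_le_iff.2 ⟨by positivity, ?_⟩
    rw [mul_pow, mul_pow, Real.sq_sqrt hlam.le, mul_right_comm, ← div_le_iff₀ hlam,
      Finset.sum_div]
    refine le_trans (Finset.sum_le_sum fun i _ => le_of_eq ?_) h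
    rw [abs_of_nonneg (Real.sqrt_nonneg _), ht2]
    ring
  -- Testing with the constant coordinate turns the upper frame bound into the bound on the weights.
  · have h := hup (WithLp.toLp 2 (0, 1))
    simp_rw [inner_extendedKernel, WithLp.prod_norm_sq_eq_of_L2] at h
    simpa using h

end
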